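/- Let $\mathbb K$ be a field of characteristic $0$, let $s\ge 1$, let $\mathbf d=(d_1,\dots,d_s)$ be nonnegative integers and $d^*=\max(d_1,\dots,d_s)$. On the polynomial algebra $\mathbb K[X_{\mathbf d}]$ in the variables $x_i^{(j)}$ ($1\le j\le s$, $0\le i\le d_j$), graded by total degree, let $\mathcal D_{\mathbf d}$ and $\mathcal D^*_{\mathbf d}$ be the $\mathbb K$-derivations with $\mathcal D_{\mathbf d}(x_i^{(j)})=i\,x_{i-1}^{(j)}$ and $\mathcal D_{\mathbf d}^*(x_i^{(j)})=(d_j-i)\,x_{i+1}^{(j)}$. Put $\mathcal S_{\mathbf d}=\ker\mathcal D_{\mathbf d}$ (joint semi-invariants), $\mathcal I_{\mathbf d}=\ker\mathcal D_{\mathbf d}\cap\ker\mathcal D_{\mathbf d}^*$ (joint invariants of binary forms of degrees $d_1,\dots,d_s$), and let $$\mathcal{PI}_{\mathbf d}(z)=\sum_{m\ge0}\dim(\mathcal I_{\mathbf d})_m z^m,\qquad \mathcal{PS}_{\mathbf d}(z)=\sum_{m\ge0}\dim(\mathcal S_{\mathbf d})_m z^m$$ be their Poincaré series. Let $$f_{\mathbf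 d}(t,z)=\prod_{j=1}^s\prod_{l=0}^{d_j}\frac1{1-tz^{d_j-2l}},$$ and let $\beta_i$ be the number of pairs $(j,l)$ with $1\le j\le s$, $0\le l\le d_j$, $d^*+d_j-2l=i$, so that $f_{\mathbf d}(tz^{d^*},z)=\prod_{i=0}^{2d^*}(1-tz^i)^{-\beta_i}$. For $n\ge0$ and a formal power series over $\mathbb C$ put $\varphi_n\left(\sum_{i\ge0}a_iz^i\right)=\sum_{i\ge0}a_{in}z^i$; in particular $\varphi_0\left(\sum_{i\ge0}a_iz^i\right)=a_0/(1-z)$. **Theorem 3.1.** There are rational functions $A_{i,k}(z)\in\mathbb C(z)$ ($0\le i\le 2d^*$, $1\le k\le\beta_i$) that give the partial fraction decomposition $$f_{\mathbf d}(tz^{d^*},z)=\sum_{i=0}^{2d^*}\sum_{k=1}^{\beta_i}\frac{A_{i,k}(z)}{(1-tz^i)^k}\quad\text{in }\mathbb C(z)(t).$$ For any such $A_{i,k}$, none of them has a pole at $z=0$, and, with $A_{i,k}$ expanded as power series at $z=0$, the following identities hold in $\mathbb C[[z]]$: $$\mathcal{PI}_{\mathbf d}(z)=\sum_{i=0}^{d^*}\sum_{k=1}^{\beta_i}\frac1{(k-1)!}\frac{d^{k-1}}{dz^{k-1}}\Big(z^{k-1}\varphi_{d^*-i}\big((1-z^2)A_{i,k}(z)\big)\Big),$$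 $$\mathcal{PS}_{\mathbf d}(z)=\sum_{i=0}^{d^*}\sum_{k=1}^{\beta_i}\frac1{(k-1)!}\frac{d^{k-1}}{dz^{k-1}}\Big(z^{k-1}\varphi_{d^*-i}\big((1+z)A_{i,k}(z)\big)\Big).$$ -/

import Mathlib

noncomputable section

namespace Weitzenbock

/-- The index set of the variables `x_i^{(j)}`, `0 ≤ i ≤ d_j`, of the algebra `K[X_d]`. -/
abbrev Var {s : ℕ} (d : Fin s → ℕ) : Type := Σ j : Fin s, Fin (d j + 1)

/-- The Weitzenböck derivation `𝒟_d` of `K[X_d]`: `x_i^{(j)} ↦ i x_{i-1}^{(j)}`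
(so `x_0^{(j)} ↦ 0`; the truncated index `0 - 1` has coefficient `0`). -/
def lowering (K : Type*) [Field K] {s : ℕ} (d : Fin s → ℕ) :
    Derivation K (MvPolynomial (Var d) K) (MvPolynomial (Var d) K) :=
  MvPolynomial.mkDerivation K fun p =>
    (p.2.val : K) • MvPolynomial.X ⟨p.1, ⟨p.2.val - 1, by omega⟩⟩

/-- The dual derivation `𝒟_d^*` of `K[X_d]`: `x_i^{(j)} ↦ (d_j - i) x_{i+1}^{(j)}`
(so `x_{d_j}^{(j)} ↦ 0`). -/
def raising (K : Type*) [Field K] {s : ℕ} (d : Fin s → ℕ) :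
    Derivation K (MvPolynomial (Var d) K) (MvPolynomial (Var d) K) :=
  MvPolynomial.mkDerivation K fun p =>
    if h : p.2.val < d p.1 then
      ((d p.1 : K) - (p.2.val : K)) • MvPolynomial.X ⟨p.1, ⟨p.2.val + 1, by omega⟩⟩
    else 0

/-- The joint semi-invariants `𝒮_d = ker 𝒟_d`, as a subspace of `K[X_d]`. -/
def semiInvariants (K : Type*) [Field K] {s : ℕ} (d : Fin s → ℕ) :
    Submodule K (MvPolynomial (Var d) K) :=
  LinearMap.ker (lowering K d).toLinearMap

/-- The joint invariants `ℐ_d = {v | 𝒟_d v = 𝒟_d^* v = 0}`, as a subspace of `K[X_d]`. -/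
def invariants (K : Type*) [Field K] {s : ℕ} (d : Fin s → ℕ) :
    Submodule K (MvPolynomial (Var d) K) :=
  LinearMap.ker (lowering K d).toLinearMap ⊓ LinearMap.ker (raising K d).toLinearMap

/-- The Poincaré series `∑_m dim (V ∩ K[x]_m) z^m` of a subspace `V` of a polynomial ring,
with respect to the grading by total degree. -/
def poincareSeries {K : Type*} [Field K] {σ : Type*}
    (V : Submodule K (MvPolynomial σ K)) : PowerSeries ℤ :=
  PowerSeries.mk fun m =>
    (Module.finrank K ↥(V ⊓ MvPolynomial.homogeneousSubmodule σ K m) : ℤ)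

/-- The Poincaré series of the algebra of joint invariants. -/
def PI (K : Type*) [Field K] {s : ℕ} (d : Fin s → ℕ) : PowerSeries ℤ :=
  poincareSeries (invariants K d)

/-- The Poincaré series of the algebra of joint semi-invariants. -/
def PS (K : Type*) [Field K] {s : ℕ} (d : Fin s → ℕ) : PowerSeries ℤ :=
  poincareSeries (semiInvariants K d)

/-- `d^* = max (d_1, …, d_s)`. -/
def dmax {s : ℕ} (d : Fin s → ℕ) : ℕ := Finset.univ.sup d

/-- `f_d(t, z) = ∏_j ∏_{l=0}^{d_j} 1 / (1 - t z^{d_j - 2 l})`, at elements `t, z` of a field. -/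
def fd {F : Type*} [Field F] {s : ℕ} (d : Fin s → ℕ) (t z : F) : F :=
  ∏ j, ∏ l ∈ Finset.range (d j + 1), (1 - t * z ^ ((d j : ℤ) - 2 * (l : ℤ)))⁻¹

/-- `β_i`: the multiplicity of the factor `1 - t z^i` in the denominator of
`f_d(t z^{d^*}, z)`, that is, the number of pairs `(j, l)` with `0 ≤ l ≤ d_j` and
`d^* + d_j - 2 l = i`. -/
def beta {s : ℕ} (d : Fin s → ℕ) (i : ℕ) : ℕ :=
  (Finset.univ.filter fun p : Var d =>
    (dmax d : ℤ) + (d p.1 : ℤ) - 2 * (p.2.val : ℤ) = (i : ℤ)).card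

/-- The field `ℂ(z)(t)` of rational functions in `t` and `z`. -/
abbrev RatTZ : Type := RatFunc (RatFunc ℂ)

/-- The element `t` of `ℂ(z)(t)`. -/
def tt : RatTZ := RatFunc.X

/-- The element `z` of `ℂ(z)(t)`. -/
def zz : RatTZ := RatFunc.C RatFunc.X

/-- The rational functions `A_{i,k}(z)` are the coefficients of a partial fraction decomposition
`f_d(t z^{d^*}, z) = ∑_{i=0}^{2 d^*} ∑_{k=1}^{β_i} A_{i,k}(z) / (1 - t z^i)^k` in `ℂ(z)(t)`. -/
def IsPartialFractionDecomposition {s : ℕ} (d : Fin s → ℕ) (A : ℕ → ℕ → RatFunc ℂ) : Prop :=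
  fd d (tt * zz ^ dmax d) zz =
    ∑ i ∈ Finset.range (2 * dmax d + 1), ∑ k ∈ Finset.Icc 1 (beta d i),
      RatFunc.C (A i k) / (1 - tt * zz ^ i) ^ k

/-- A rational function has no pole at `0`. -/
def RegularAtZero (R : RatFunc ℂ) : Prop := R.denom.eval 0 ≠ 0

/-- The power series expansion at `0` of a rational function that has no pole at `0`
(a junk value otherwise). -/
def expansion (R : RatFunc ℂ) : PowerSeries ℂ :=
  (R.num : PowerSeries ℂ) * (R.denom : PowerSeries ℂ)⁻¹

/-- `φ_n (∑_i a_i z^i) = ∑_i a_{i n} z^i`. In particular `φ_0 (a) = a_0 / (1 - z)`. -/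
def phi (n : ℕ) (a : PowerSeries ℂ) : PowerSeries ℂ :=
  PowerSeries.mk fun i => PowerSeries.coeff (i * n) a

/-- `1 / (k-1)! · d^{k-1} (z^{k-1} a(z)) / dz^{k-1}` for a formal power series `a`, `k ≥ 1`. -/
def springerOp (k : ℕ) (a : PowerSeries ℂ) : PowerSeries ℂ :=
  (((k - 1).factorial : ℂ)⁻¹) •
    (PowerSeries.derivative ℂ)^[k - 1] ((PowerSeries.X : PowerSeries ℂ) ^ (k - 1) * a)

end Weitzenbock

end

noncomputable section

namespace Weitzenbock

/-! ### Representations of sl₂ and the bigrading of the polynomial algebra -/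

section

/-! Give `x_i^{(j)}` the weight `d_j - 2i`. Then `𝒟` raises weights by 2, `𝒟*` lowers them by 2, and
their commutator multiplies a vector of weight `w` by `w`. As in sl₂ theory, `𝒟` is injective on
negative weights and maps weight `w - 2` onto weight `w` for `w > 0`. With `c(m, w)` the number of
monomials of degree `m` and weight `w`, rank-nullity gives `c(m, 0) - c(m, 2)` for the invariants
(`coeff_PI`) and `c(m, 0) + c(m, 1)` for the semi-invariants (`coeff_PS`).

By the symmetry `w ↦ -w`, `c(m, j)` is the coefficient of `t^m z^{m d*}` in `z^j f_d(t z^{d*}, z)`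
(`coeff_sum_X_pow`), so both series are diagonals of `u f_d(t z^{d*}, z)` with `u = 1 - z²` or `u =
1 + z`. A partial fraction `A / (1 - t z^i)^k` contributes `binom(k-1+m, k-1)` times the coefficient
of `z^{m(d* - i)}` in `u A`. Taking that coefficient is `φ_{d* - i}`, and the binomial factor is the
differential operator (`coeff_springerOp`).

Terms with `i > d*` contribute nothing for `m > 0`. For `m = 0` they drop out because `A_{i,k}`
vanishes at `z = 0` whenever `i ≠ 0`. This vanishing is built into `poleSpan`, in which the
decomposition is constructed one factor at a time; `poles_unique` transfers it to any decomposition.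
-/

/-- Linear maps `D`, `E` that move a family of subspaces `V w`, `w ∈ ℤ`, by `2` and `-2` and whose
commutator acts on `V w` as the scalar `w`, all but finitely many of the `V w` being zero. -/
structure IsSl2Graded {K M : Type*} [Field K] [AddCommGroup M] [Module K M]
    (D E : M →ₗ[K] M) (V : ℤ → Submodule K M) : Prop where
  raise : ∀ {w : ℤ} {v : M}, v ∈ V w → D v ∈ V (w + 2)
  lower : ∀ {w : ℤ} {v : M}, v ∈ V w → E v ∈ V (w - 2)
  comm : ∀ {w : ℤ} {v : M}, v ∈ V w → D (E v) - E (D v) = (w : K) • v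
  bounded : ∃ N : ℕ, ∀ {w : ℤ} {v : M}, (N : ℤ) < |w| → v ∈ V w → v = 0

namespace IsSl2Graded

variable {K M : Type*} [Field K] [CharZero K] [AddCommGroup M] [Module K M]
  {D E : M →ₗ[K] M} {V : ℤ → Submodule K M}

lemma eq_zero_of_lower_raise_eq (h : IsSl2Graded D E V) {c w : ℤ} (hc : c < 0) (hw : -2 ≤ w)
    {v : M} (hv : v ∈ V w) (hDE : E (D v) = (c : K) • v) : v = 0 := by
  obtain ⟨N, hN⟩ := h.bounded
  obtain ⟨n, hn⟩ : ∃ n : ℕ, (N : ℤ) - w < n :=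
    ⟨((N : ℤ) - w).toNat + 1, by push_cast; omega⟩
  induction n generalizing c w v with
  | zero => exact hN (lt_of_lt_of_le (by simpa using hn) (le_abs_self w)) hv
  | succ n ih =>
    have hD : D v ∈ V (w + 2) := h.raise hv
    have hDv : D v = 0 := by
      refine ih (c := c - (w + 2)) (by omega) (by omega) hD ?_ (by push_cast at hn; omega)
      have := h.comm hD
      rw [hDE, map_smul, sub_eq_iff_eq_add, ← sub_eq_iff_eq_add'] at this
      rw [← this, ← sub_smul]
      push_cast; rfl
    rw [hDv, map_zero] at hDE
    exact (smul_eq_zero.mp hDE.symm).resolve_left (by exact_mod_cast hc.ne)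

/-- Applying `E` turns the eigenvalue `c` into `c + (w - 2) ≤ c`, still negative, at weight `w - 2`.
Weights are bounded, so `E v = 0` after finitely many steps, and then `c • v = 0`. The previous
lemma is the mirror image. -/
lemma eq_zero_of_raise_lower_eq (h : IsSl2Graded D E V) {c w : ℤ} (hc : c < 0) (hw : w ≤ 2)
    {v : M} (hv : v ∈ V w) (hDE : D (E v) = (c : K) • v) : v = 0 := by
  obtain ⟨N, hN⟩ := h.bounded
  obtain ⟨n, hn⟩ : ∃ n : ℕ, (N : ℤ) + w < n :=
    ⟨((N : ℤ) + w).toNat + 1, by push_cast; omega⟩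
  induction n generalizing c w v with
  | zero => exact hN (lt_of_lt_of_le (by push_cast at hn; omega) (neg_le_abs w)) hv
  | succ n ih =>
    have hE : E v ∈ V (w - 2) := h.lower hv
    have hEv : E v = 0 := by
      refine ih (c := c + (w - 2)) (by omega) (by omega) hE ?_ (by push_cast at hn; omega)
      have := h.comm hE
      rw [hDE, map_smul, sub_eq_iff_eq_add] at this
      rw [this, ← add_smul, add_comm]
      push_cast; rfl
    rw [hEv, map_zero] at hDE
    exact (smul_eq_zero.mp hDE.symm).resolve_left (by exact_mod_cast hc.ne)

lemma eq_zero_of_raise_eq_zero (h : IsSl2Graded D E V) {w : ℤ} (hw : w < 0) {v : M}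
    (hv : v ∈ V w) (hD : D v = 0) : v = 0 := by
  refine h.eq_zero_of_raise_lower_eq hw (by omega) hv ?_
  simpa [hD] using h.comm hv

/-- On `V w` with `w > 0`, `D ∘ E` is injective: `D (E x) = 0` forces `E (D x) = -w • x`, a negative
eigenvalue. By finite dimension it is also surjective, and `u` is of the form `E x`. -/
lemma exists_raise_eq (h : IsSl2Graded D E V) [∀ w, FiniteDimensional K (V w)] {w : ℤ}
    (hw : 0 < w) {v : M} (hv : v ∈ V w) : ∃ u ∈ V (w - 2), D u = v := by
  have hmap : ∀ x ∈ V w, (D ∘ₗ E) x ∈ V w := fun x hx => by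
    simpa using h.raise (h.lower hx)
  have hinj : Function.Injective ((D ∘ₗ E).restrict hmap) := by
    rw [injective_iff_map_eq_zero]
    rintro ⟨x, hx⟩ hx0
    replace hx0 : D (E x) = 0 := congrArg Subtype.val hx0
    refine Subtype.ext (h.eq_zero_of_lower_raise_eq (c := -w) (by omega) (by omega) hx ?_)
    have := h.comm hx
    rw [hx0, zero_sub, neg_eq_iff_eq_neg] at this
    rw [this]; push_cast; rw [neg_smul]
  obtain ⟨⟨x, hx⟩, hxv⟩ := (LinearMap.injective_iff_surjective.mp hinj) ⟨v, hv⟩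
  exact ⟨E x, h.lower hx, congrArg Subtype.val hxv⟩

end IsSl2Graded

open MvPolynomial

lemma mkDerivation_isWeightedHomogeneous {R σ A : Type*} [CommRing R] [AddCommGroup A]
    {w : σ → A} {a : A} {f : σ → MvPolynomial σ R}
    (hf : ∀ p, IsWeightedHomogeneous w (f p) (w p + a)) {n : A} {φ : MvPolynomial σ R}
    (hφ : IsWeightedHomogeneous w φ n) :
    IsWeightedHomogeneous w (mkDerivation R f φ) (n + a) := by
  induction hφ using IsWeightedHomogeneous.induction_on with
  | zero => simpa using isWeightedHomogeneous_zero R w _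
  | add p q hp hq h1 h2 => simpa using h1.add h2
  | monomial s r hs =>
    rw [mkDerivation_monomial]
    refine Submodule.smul_mem (weightedHomogeneousSubmodule R w _) _
      (Submodule.sum_mem _ fun i hi => ?_)
    have key : n + a = (Finsupp.weight w (s - Finsupp.single i 1)) + (w i + a) := by
      rw [← hs, ← add_assoc]
      congr 1
      have hle : Finsupp.single i 1 ≤ s := by
        rw [Finsupp.single_le_iff]; exact Nat.one_le_iff_ne_zero.mpr (Finsupp.mem_support_iff.mp hi)
      conv_lhs => rw [← tsub_add_cancel_of_le hle]
      rw [map_add, Finsupp.weight_single, one_smul]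
    rw [mem_weightedHomogeneousSubmodule, key]
    exact (isWeightedHomogeneous_monomial w _ _ rfl).mul (hf i)

lemma coeff_mkDerivation_C_mul_X {R σ : Type*} [CommRing R] (c : σ → R)
    (s : σ →₀ ℕ) (φ : MvPolynomial σ R) :
    coeff s (mkDerivation R (fun p => c p • X p) φ) = Finsupp.weight c s * coeff s φ := by
  classical
  induction φ using MvPolynomial.induction_on' with
  | add p q hp hq => simp [hp, hq, mul_add]
  | monomial t r =>
    have : mkDerivation R (fun p => c p • X p) (monomial t r) =
        monomial t (Finsupp.weight c t * r) := by
      rw [mkDerivation_monomial, Finsupp.weight_apply, Finsupp.sum, Finsupp.sum, Finset.sum_mul,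
        Finset.smul_sum, map_sum]
      refine Finset.sum_congr rfl fun i hi => ?_
      rw [smul_eq_mul, X, smul_monomial, monomial_mul, smul_monomial, tsub_add_cancel_of_le]
      · congr 1; simp; ring
      · rw [Finsupp.single_le_iff]; exact Nat.one_le_iff_ne_zero.mpr (Finsupp.mem_support_iff.mp hi)
    rw [this, coeff_monomial, coeff_monomial]
    split_ifs with h
    · rw [h]
    · simp

lemma weightedHomogeneousComponent_apply_of_shift {R σ A : Type*} [CommRing R] [AddCommGroup A]
    {w : σ → A} {a : A} {D : MvPolynomial σ R →ₗ[R] MvPolynomial σ R}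
    (hD : ∀ n φ, IsWeightedHomogeneous w φ n → IsWeightedHomogeneous w (D φ) (n + a)) (n : A)
    (φ : MvPolynomial σ R) :
    weightedHomogeneousComponent w (n + a) (D φ) = D (weightedHomogeneousComponent w n φ) := by
  classical
  induction φ using MvPolynomial.induction_on' with
  | add p q hp hq => simp [hp, hq]
  | monomial t r =>
    have ht := isWeightedHomogeneous_monomial w t r rfl
    rw [weightedHomogeneousComponent_of_mem (hD _ _ ht), weightedHomogeneousComponent_of_mem ht]
    simp only [add_left_inj]
    split_ifs <;> simp

variable {K : Type*} [Field K] {s : ℕ} (d : Fin s → ℕ)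

/-- The weight `d_j - 2 i` of the variable `x_i^{(j)}`. -/
def varWeight (p : Var d) : ℤ := (d p.1 : ℤ) - 2 * (p.2.val : ℤ)

/-- The bidegree of the variable `x_i^{(j)}`: its degree and its weight. -/
def varBidegree (p : Var d) : ℤ × ℤ := (1, varWeight d p)

/-- The span of the monomials of degree `m` and weight `w`. -/
def weightSpace (K : Type*) [Field K] (m : ℕ) (w : ℤ) : Submodule K (MvPolynomial (Var d) K) :=
  weightedHomogeneousSubmodule K (varBidegree d) (m, w)

lemma weight_varBidegree (t : Var d →₀ ℕ) :
    Finsupp.weight (varBidegree d) t = ((t.degree : ℤ), Finsupp.weight (varWeight d) t) := by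
  simp only [Finsupp.weight_apply, Finsupp.degree_apply, varBidegree, Finsupp.sum]
  ext
  · simp [Prod.fst_sum]
  · simp [Prod.snd_sum]

/-- Lowering the index `i` raises the weight `d_j - 2i`, so `lowering` plays the role of `D` and
`raising` that of `E`. -/
lemma lowering_isWeightedHomogeneous (n : ℤ × ℤ) (φ : MvPolynomial (Var d) K)
    (hφ : IsWeightedHomogeneous (varBidegree d) φ n) :
    IsWeightedHomogeneous (varBidegree d) ((lowering K d).toLinearMap φ) (n + (0, 2)) := by
  refine mkDerivation_isWeightedHomogeneous (fun p => ?_) hφ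
  by_cases hp : p.2.val = 0
  · simpa [hp] using isWeightedHomogeneous_zero K (varBidegree d) _
  · refine Submodule.smul_mem (weightedHomogeneousSubmodule K _ _) _ ?_
    have : varBidegree d p + (0, 2) = varBidegree d ⟨p.1, ⟨p.2.val - 1, by omega⟩⟩ := by
      simp only [varBidegree, varWeight, Prod.mk_add_mk, add_zero, Prod.mk.injEq, true_and]
      omega
    rw [this]
    exact isWeightedHomogeneous_X K _ _

lemma raising_isWeightedHomogeneous (n : ℤ × ℤ) (φ : MvPolynomial (Var d) K)
    (hφ : IsWeightedHomogeneous (varBidegree d) φ n) :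
    IsWeightedHomogeneous (varBidegree d) ((raising K d).toLinearMap φ) (n + (0, -2)) := by
  refine mkDerivation_isWeightedHomogeneous (fun p => ?_) hφ
  split_ifs with hp
  · refine Submodule.smul_mem (weightedHomogeneousSubmodule K _ _) _ ?_
    have : varBidegree d p + (0, -2) = varBidegree d ⟨p.1, ⟨p.2.val + 1, by omega⟩⟩ := by
      simp only [varBidegree, varWeight, Prod.mk_add_mk, add_zero, Prod.mk.injEq, true_and]
      push_cast; ring
    rw [this]
    exact isWeightedHomogeneous_X K _ _
  · exact isWeightedHomogeneous_zero K (varBidegree d) _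

/-- Both sides are derivations, so it suffices to compare them on variables, where `(d_j - i)(i + 1)
- i(d_j - i + 1) = d_j - 2i`. -/
lemma commutator_eq : ⁅lowering K d, raising K d⁆ =
    mkDerivation K fun p => ((varWeight d p : ℤ) : K) • X p := by
  refine derivation_ext fun p => ?_
  obtain ⟨j, i, hi⟩ := p
  have h1 : lowering K d (raising K d (X ⟨j, i, hi⟩)) =
      (((d j : K) - i) * (i + 1)) • X ⟨j, i, hi⟩ := by
    simp only [lowering, raising, mkDerivation_X]
    split_ifs with h
    · simp [smul_smul]
    · have : d j = i := by simp at h; omega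
      simp [this]
  have h2 : raising K d (lowering K d (X ⟨j, i, hi⟩)) =
      ((i : K) * (d j - i + 1)) • X ⟨j, i, hi⟩ := by
    rcases i with _ | i
    · simp [lowering]
    · have : i < d j := by omega
      simp [lowering, raising, this, smul_smul]
      left; ring
  rw [Derivation.commutator_apply, h1, h2, mkDerivation_X, ← sub_smul]
  congr 1
  simp [varWeight]
  ring

lemma coeff_commutator (t : Var d →₀ ℕ) (φ : MvPolynomial (Var d) K) :
    coeff t (lowering K d (raising K d φ) - raising K d (lowering K d φ)) =
      ((Finsupp.weight (varWeight d) t : ℤ) : K) * coeff t φ := by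
  rw [← Derivation.commutator_apply, commutator_eq, coeff_mkDerivation_C_mul_X]
  congr 1
  simp [Finsupp.weight_apply, Finsupp.sum]

lemma mem_weightSpace {m : ℕ} {w : ℤ} {φ : MvPolynomial (Var d) K} :
    φ ∈ weightSpace d K m w ↔
      ∀ t ∈ φ.support, t.degree = m ∧ Finsupp.weight (varWeight d) t = w := by
  simp [weightSpace, IsWeightedHomogeneous, weight_varBidegree]

lemma weight_varWeight_bounded (t : Var d →₀ ℕ) :
    |Finsupp.weight (varWeight d) t| ≤ t.degree * (dmax d : ℤ) := by
  rw [Finsupp.weight_apply, Finsupp.sum, Finsupp.degree_apply]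
  push_cast
  rw [Finset.sum_mul]
  refine (Finset.abs_sum_le_sum_abs _ _).trans (Finset.sum_le_sum fun p _ => ?_)
  have h : d p.1 ≤ dmax d := Finset.le_sup (f := d) (Finset.mem_univ p.1)
  have := p.2.isLt
  rw [nsmul_eq_mul, abs_mul, Nat.abs_cast]
  refine mul_le_mul_of_nonneg_left (abs_le.mpr ?_) (by positivity)
  unfold varWeight
  constructor <;> omega

lemma isSl2Graded_weightSpace (m : ℕ) :
    IsSl2Graded (lowering K d).toLinearMap (raising K d).toLinearMap (weightSpace d K m) where
  raise hv := by simpa [weightSpace] using lowering_isWeightedHomogeneous d _ _ hv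
  lower hv := by
    simpa [weightSpace, sub_eq_add_neg] using raising_isWeightedHomogeneous d _ _ hv
  comm {w v} hv := by
    ext t
    rw [coeff_smul, smul_eq_mul]
    refine (coeff_commutator d t v).trans ?_
    by_cases ht : t ∈ v.support
    · rw [((mem_weightSpace d).mp hv t ht).2]
    · rw [notMem_support_iff.mp ht]; simp
  bounded := by
    refine ⟨m * dmax d, fun {w v} hw hv => ?_⟩
    rw [← support_eq_empty, Finset.eq_empty_iff_forall_notMem]
    intro t ht
    obtain ⟨h1, h2⟩ := (mem_weightSpace d).mp hv t ht
    have := weight_varWeight_bounded d t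
    rw [h1, h2] at this
    push_cast at hw
    omega

end

/-! ### Dimensions of invariants and semi-invariants as monomial counts -/

section

open MvPolynomial

lemma finrank_restrictSupport {R σ : Type*} [CommRing R] [Nontrivial R]
    (S : Set (σ →₀ ℕ)) : Module.finrank R (restrictSupport R S) = Nat.card S :=
  Module.finrank_eq_nat_card_basis (basisRestrictSupport R S)

lemma finite_restrictSupport {R σ : Type*} [CommRing R] {S : Set (σ →₀ ℕ)} (hS : S.Finite) :
    Module.Finite R (restrictSupport R S) :=
  have := hS.to_subtype
  Module.Finite.of_basis (basisRestrictSupport R S)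

/-- The rank-nullity theorem for a linear map that sends a subspace onto another one. -/
lemma finrank_ker_inf_add_finrank {K M : Type*} [Field K] [AddCommGroup M] [Module K M]
    (D : M →ₗ[K] M) {U V : Submodule K M} [FiniteDimensional K U] (h : U.map D = V) :
    Module.finrank K ↥(LinearMap.ker D ⊓ U) + Module.finrank K V = Module.finrank K U := by
  rw [← LinearMap.finrank_range_add_finrank_ker (D.domRestrict U), add_comm, ← h,
    LinearMap.range_domRestrict, LinearMap.ker_domRestrict]
  congr 1
  rw [← Submodule.finrank_map_subtype_eq, Submodule.map_comap_subtype, inf_comm]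

variable {K : Type*} [Field K] {s : ℕ} (d : Fin s → ℕ)

/-- The exponents of the monomials of degree `m` whose weight lies in `W`. -/
def exponents (m : ℕ) (W : Set ℤ) : Set (Var d →₀ ℕ) :=
  {t | t.degree = m ∧ Finsupp.weight (varWeight d) t ∈ W}

lemma finite_exponents (m : ℕ) (W : Set ℤ) : (exponents d m W).Finite :=
  (Finsupp.finite_of_degree_le m).subset fun _ ht => ht.1.le

lemma weightSpace_eq (m : ℕ) (w : ℤ) :
    weightSpace d K m w = restrictSupport K (exponents d m {w}) := by
  ext φ
  rw [mem_weightSpace, mem_restrictSupport_iff]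
  rfl

instance (m : ℕ) (w : ℤ) : FiniteDimensional K (weightSpace d K m w) := by
  rw [weightSpace_eq]
  exact finite_restrictSupport (finite_exponents d m _)

lemma homogeneousSubmodule_eq (m : ℕ) :
    homogeneousSubmodule (Var d) K m = restrictSupport K (exponents d m Set.univ) := by
  ext φ
  rw [mem_homogeneousSubmodule, mem_restrictSupport_iff]
  simp only [IsHomogeneous, IsWeightedHomogeneous, exponents, Set.subset_def, Finset.mem_coe,
    mem_support_iff, Set.mem_univ, and_true, Set.mem_ofPred_eq, Finsupp.degree_eq_weight_one]
  rfl

lemma restrictSupport_exponents_le {m : ℕ} {W : Set ℤ} {P : Submodule K (MvPolynomial (Var d) K)}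
    (h : ∀ w ∈ W, weightSpace d K m w ≤ P) : restrictSupport K (exponents d m W) ≤ P := by
  rw [restrictSupport_eq_span, Submodule.span_le]
  rintro _ ⟨t, ⟨ht, htW⟩, rfl⟩
  refine h _ htW ?_
  rw [weightSpace_eq]
  exact (monomial_mem_restrictSupport _).mpr (Or.inl ⟨ht, rfl⟩)

lemma weightSpace_le {m : ℕ} {W : Set ℤ} {w : ℤ} (hw : w ∈ W) :
    weightSpace d K m w ≤ restrictSupport K (exponents d m W) := by
  rw [weightSpace_eq]
  exact restrictSupport_mono _ fun t ht => ⟨ht.1, by rw [ht.2]; exact hw⟩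

/-- The number of monomials of degree `m` and weight `w`. -/
def monomialCount (m : ℕ) (w : ℤ) : ℕ := (exponents d m {w}).ncard

lemma finrank_weightSpace (m : ℕ) (w : ℤ) :
    Module.finrank K (weightSpace d K m w) = monomialCount d m w := by
  rw [weightSpace_eq, finrank_restrictSupport]
  rfl

variable [CharZero K]

/-- The Weitzenböck derivation sends the part of weight `≥ a - 2` onto the part of weight `≥ a`. -/
lemma map_lowering_restrictSupport_Ici (m : ℕ) {a : ℤ} (ha : 0 < a) :
    (restrictSupport K (exponents d m (Set.Ici (a - 2)))).map (lowering K d).toLinearMap =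
      restrictSupport K (exponents d m (Set.Ici a)) := by
  refine le_antisymm (Submodule.map_le_iff_le_comap.mpr ?_) ?_
  · refine restrictSupport_exponents_le d fun w hw φ hφ => ?_
    exact weightSpace_le d (show w + 2 ∈ Set.Ici a by simp at hw ⊢; omega)
      ((isSl2Graded_weightSpace d m).raise hφ)
  · refine restrictSupport_exponents_le d fun w hw φ hφ => ?_
    obtain ⟨ψ, hψ, rfl⟩ := (isSl2Graded_weightSpace d m).exists_raise_eq (lt_of_lt_of_le ha hw) hφ
    exact ⟨ψ, weightSpace_le d (by simp at hw ⊢; omega) hψ, rfl⟩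

lemma map_lowering_weightSpace (m : ℕ) {w : ℤ} (hw : 0 < w) :
    (weightSpace d K m (w - 2)).map (lowering K d).toLinearMap = weightSpace d K m w := by
  refine le_antisymm (Submodule.map_le_iff_le_comap.mpr fun φ hφ => ?_) fun φ hφ => ?_
  · simpa using (isSl2Graded_weightSpace d m).raise hφ
  · exact (isSl2Graded_weightSpace d m).exists_raise_eq hw hφ

/-- The derivation shifts bidegrees, so it kills each bihomogeneous component of `φ`; on negative
weights it is injective. -/
lemma weight_nonneg_of_mem_semiInvariants {φ : MvPolynomial (Var d) K}
    (hφ : φ ∈ semiInvariants K d) {t : Var d →₀ ℕ} (ht : t ∈ φ.support) :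
    0 ≤ Finsupp.weight (varWeight d) t := by
  classical
  by_contra! hlt
  set ψ := weightedHomogeneousComponent (varBidegree d) (Finsupp.weight (varBidegree d) t) φ
    with hψ
  have hmem : ψ ∈ weightSpace d K t.degree (Finsupp.weight (varWeight d) t) := by
    rw [weightSpace, ← weight_varBidegree]
    exact weightedHomogeneousComponent_mem _ _ _
  have hD : (lowering K d).toLinearMap ψ = 0 := by
    rw [hψ, ← weightedHomogeneousComponent_apply_of_shift (lowering_isWeightedHomogeneous d),
      LinearMap.mem_ker.mp hφ, map_zero]
  have h0 := (isSl2Graded_weightSpace d t.degree).eq_zero_of_raise_eq_zero hlt hmem hD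
  have := congrArg (coeff t) h0
  rw [hψ, coeff_weightedHomogeneousComponent, if_pos rfl, coeff_zero] at this
  exact mem_support_iff.mp ht this

lemma semiInvariants_inf_homogeneousSubmodule (m : ℕ) :
    semiInvariants K d ⊓ homogeneousSubmodule (Var d) K m =
      LinearMap.ker (lowering K d).toLinearMap ⊓
        restrictSupport K (exponents d m (Set.Ici 0)) := by
  rw [homogeneousSubmodule_eq]
  refine le_antisymm (fun φ hφ => ⟨hφ.1, ?_⟩)
    (inf_le_inf le_rfl (restrictSupport_mono _ fun t ht => ⟨ht.1, trivial⟩))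
  exact fun t ht => ⟨(hφ.2 ht).1, weight_nonneg_of_mem_semiInvariants d hφ.1 ht⟩

/-- A vector killed by both derivations is killed by the commutator, hence has weight 0 in
characteristic 0. Conversely, if `v` has weight 0 and `D v = 0`, then `D (E v) = 0` with `E v` of
weight -2, so `E v = 0`. -/
lemma invariants_inf_homogeneousSubmodule (m : ℕ) :
    invariants K d ⊓ homogeneousSubmodule (Var d) K m =
      LinearMap.ker (lowering K d).toLinearMap ⊓ weightSpace d K m 0 := by
  have h := isSl2Graded_weightSpace (K := K) d m
  rw [homogeneousSubmodule_eq]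
  refine le_antisymm (fun φ hφ => ?_) (fun φ hφ => ?_)
  · rw [weightSpace_eq]
    refine ⟨hφ.1.1, ?_⟩
    refine fun t ht => ⟨(hφ.2 ht).1, ?_⟩
    have hD : lowering K d φ = 0 := hφ.1.1
    have hE : raising K d φ = 0 := hφ.1.2
    have := coeff_commutator d t φ
    rw [hD, hE, map_zero, map_zero, sub_zero, coeff_zero, zero_eq_mul] at this
    exact Int.cast_eq_zero.mp (this.resolve_right (mem_support_iff.mp ht))
  · refine ⟨⟨hφ.1, ?_⟩, weightSpace_le d (Set.mem_univ _) hφ.2⟩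
    refine h.eq_zero_of_raise_eq_zero (by norm_num) (h.lower hφ.2) ?_
    have := h.comm hφ.2
    rwa [LinearMap.mem_ker.mp hφ.1, map_zero, sub_zero, Int.cast_zero, zero_smul] at this

lemma coeff_PI (m : ℕ) : PowerSeries.coeff m (PI K d) =
    (monomialCount d m 0 : ℤ) - monomialCount d m 2 := by
  rw [PI, poincareSeries, PowerSeries.coeff_mk, invariants_inf_homogeneousSubmodule]
  have := finrank_ker_inf_add_finrank _ (map_lowering_weightSpace (K := K) d m (w := 2) two_pos)
  rw [sub_self, finrank_weightSpace, finrank_weightSpace] at this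
  omega

/-- The derivation maps weights `≥ 0` onto weights `≥ 2`, so the kernel has the dimension of the
parts of weight 0 and 1. -/
lemma coeff_PS (m : ℕ) : PowerSeries.coeff m (PS K d) =
    (monomialCount d m 0 : ℤ) + monomialCount d m 1 := by
  rw [PS, poincareSeries, PowerSeries.coeff_mk, semiInvariants_inf_homogeneousSubmodule]
  have hfin : Module.Finite K (restrictSupport K (exponents d m (Set.Ici (2 - 2)))) :=
    finite_restrictSupport (finite_exponents d m _)
  have := finrank_ker_inf_add_finrank _
    (map_lowering_restrictSupport_Ici (K := K) d m (a := 2) two_pos)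
  rw [sub_self, finrank_restrictSupport, finrank_restrictSupport, Nat.card_coe_set_eq,
    Nat.card_coe_set_eq] at this
  have hcard : (exponents d m (Set.Ici 0)).ncard =
      monomialCount d m 0 + monomialCount d m 1 + (exponents d m (Set.Ici 2)).ncard := by
    rw [monomialCount, monomialCount, ← Set.ncard_union_eq _ (finite_exponents d m _)
      (finite_exponents d m _), ← Set.ncard_union_eq _ (Set.Finite.union (finite_exponents d m _)
      (finite_exponents d m _)) (finite_exponents d m _)]
    · congr 1
      ext t
      simp only [exponents, Set.mem_ofPred_eq, Set.mem_Ici, Set.mem_union, Set.mem_singleton_iff,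
        ← and_or_left]
      exact and_congr_right fun _ => by omega
    · rw [Set.disjoint_left]
      rintro t (⟨-, h⟩ | ⟨-, h⟩) ⟨-, h'⟩ <;> simp at h h' <;> omega
    · rw [Set.disjoint_left]
      rintro t ⟨-, h⟩ ⟨-, h'⟩
      simp at h h'; omega
  omega

/-- The involution `x_i^{(j)} ↦ x_{d_j - i}^{(j)}` of the variables. -/
def varRev : Var d ≃ Var d := Equiv.sigmaCongrRight fun _ => Fin.revPerm

lemma varWeight_varRev (p : Var d) : varWeight d (varRev d p) = -varWeight d p := by
  obtain ⟨j, i, hi⟩ := p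
  have : (varRev d ⟨j, i, hi⟩).2.val = d j - i := by
    change (Fin.rev (⟨i, hi⟩ : Fin (d j + 1))).val = _
    rw [Fin.val_rev]; simp
  have h1 : (varRev d ⟨j, i, hi⟩).1 = j := rfl
  rw [varWeight, this, varWeight, h1]
  push_cast [show i ≤ d j by omega]
  ring

lemma monomialCount_neg (m : ℕ) (w : ℤ) : monomialCount d m (-w) = monomialCount d m w := by
  refine Nat.card_congr ((Finsupp.equivCongrLeft (varRev d)).subtypeEquiv fun t => ?_)
  have h1 : (Finsupp.equivCongrLeft (varRev d) t).degree = t.degree := by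
    rw [Finsupp.degree_eq_sum, Finsupp.degree_eq_sum, ← Equiv.sum_comp (varRev d)]
    simp
  have h2 : Finsupp.weight (varWeight d) (Finsupp.equivCongrLeft (varRev d) t) =
      -Finsupp.weight (varWeight d) t := by
    rw [Finsupp.weight_apply, Finsupp.weight_apply, Finsupp.sum_fintype _ _ (by simp),
      Finsupp.sum_fintype _ _ (by simp), ← Equiv.sum_comp (varRev d), ← Finset.sum_neg_distrib]
    simp [varWeight_varRev]
  simp only [exponents, Set.mem_ofPred_eq, Set.mem_singleton_iff, h1, h2, neg_eq_iff_eq_neg]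

end

/-! ### Expansions at zero and products of poles -/

section

open scoped LaurentSeries RatFunc

/-- The rational function `r` has the power series expansion `f` at `0`. -/
def HasExpansion {F : Type*} [Field F] (r : RatFunc F) (f : PowerSeries F) : Prop :=
  algebraMap (RatFunc F) F⸨X⸩ r = HahnSeries.ofPowerSeries ℤ F f

namespace HasExpansion

variable {F : Type*} [Field F] {r r' : RatFunc F} {f f' : PowerSeries F}

lemma add (h : HasExpansion r f) (h' : HasExpansion r' f') : HasExpansion (r + r') (f + f') := by
  rw [HasExpansion, map_add, map_add, h, h']

lemma neg (h : HasExpansion r f) : HasExpansion (-r) (-f) := by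
  rw [HasExpansion, map_neg, map_neg, h]

lemma mul (h : HasExpansion r f) (h' : HasExpansion r' f') : HasExpansion (r * r') (f * f') := by
  rw [HasExpansion, map_mul, map_mul, h, h']

lemma pow (h : HasExpansion r f) (n : ℕ) : HasExpansion (r ^ n) (f ^ n) := by
  rw [HasExpansion, map_pow, map_pow, h]

lemma sum {ι : Type*} {s : Finset ι} {r : ι → RatFunc F} {f : ι → PowerSeries F}
    (h : ∀ i ∈ s, HasExpansion (r i) (f i)) : HasExpansion (∑ i ∈ s, r i) (∑ i ∈ s, f i) := by
  rw [HasExpansion, map_sum, map_sum]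
  exact Finset.sum_congr rfl h

lemma prod {ι : Type*} {s : Finset ι} {r : ι → RatFunc F} {f : ι → PowerSeries F}
    (h : ∀ i ∈ s, HasExpansion (r i) (f i)) : HasExpansion (∏ i ∈ s, r i) (∏ i ∈ s, f i) := by
  rw [HasExpansion, map_prod, map_prod]
  exact Finset.prod_congr rfl h

lemma zero : HasExpansion (0 : RatFunc F) 0 := by simp [HasExpansion]

lemma one : HasExpansion (1 : RatFunc F) 1 := by simp [HasExpansion]

lemma natCast (n : ℕ) : HasExpansion (n : RatFunc F) (n : PowerSeries F) := by
  simp [HasExpansion]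

lemma polynomial (p : Polynomial F) :
    HasExpansion (algebraMap (Polynomial F) (RatFunc F) p) (p : PowerSeries F) :=
  (RatFunc.coe_coe p).symm

lemma X : HasExpansion (RatFunc.X : RatFunc F) PowerSeries.X := by
  simpa using polynomial (Polynomial.X : Polynomial F)

lemma C (a : F) : HasExpansion (RatFunc.C a) (PowerSeries.C a) := by
  simpa using polynomial (Polynomial.C a)

lemma unique (h : HasExpansion r f) (h' : HasExpansion r f') : f = f' :=
  HahnSeries.ofPowerSeries_injective (h.symm.trans h')

lemma inv_of_mul_eq_one (h : HasExpansion r f) (hf : f * f' = 1) : HasExpansion r⁻¹ f' := by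
  rw [HasExpansion, map_inv₀, h]
  refine inv_eq_of_mul_eq_one_right ?_
  rw [← map_mul, hf, map_one]

lemma inv (h : HasExpansion r f) (hf : PowerSeries.constantCoeff f ≠ 0) :
    HasExpansion r⁻¹ f⁻¹ :=
  h.inv_of_mul_eq_one (PowerSeries.mul_inv_cancel f hf)

lemma num_eq_mul_denom (h : HasExpansion r f) :
    (r.num : PowerSeries F) = f * (r.denom : PowerSeries F) := by
  refine (polynomial r.num).unique ?_
  have hr : algebraMap (Polynomial F) (RatFunc F) r.num = r * algebraMap _ _ r.denom := by
    conv_rhs => enter [1]; rw [← RatFunc.num_div_denom r]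
    exact (div_mul_cancel₀ _ (RatFunc.algebraMap_ne_zero r.denom_ne_zero)).symm
  rw [hr]
  exact h.mul (polynomial r.denom)

/-- Since `num = f * denom` as power series, a zero of the denominator at 0 would be shared by the
numerator, against coprimality. -/
lemma denom_eval_zero_ne_zero (h : HasExpansion r f) : r.denom.eval 0 ≠ 0 := by
  intro h0
  have h1 : r.num.eval 0 = 0 := by
    have := congrArg PowerSeries.constantCoeff h.num_eq_mul_denom
    rw [map_mul, Polynomial.constantCoeff_coe, Polynomial.constantCoeff_coe] at this
    rw [← Polynomial.coeff_zero_eq_eval_zero] at h0 ⊢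
    rw [this, h0, mul_zero]
  obtain ⟨a, b, hab⟩ := r.isCoprime_num_denom
  have := congrArg (Polynomial.eval 0) hab
  simp [h0, h1] at this

lemma num_mul_inv_denom (h : HasExpansion r f) :
    (r.num : PowerSeries F) * (r.denom : PowerSeries F)⁻¹ = f := by
  have h0 : PowerSeries.constantCoeff (r.denom : PowerSeries F) ≠ 0 := by
    rw [Polynomial.constantCoeff_coe, Polynomial.coeff_zero_eq_eval_zero]
    exact h.denom_eval_zero_ne_zero
  rw [h.num_eq_mul_denom, mul_assoc, PowerSeries.mul_inv_cancel _ h0, mul_one]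

end HasExpansion

/-- The rational functions that have a power series expansion at `0`. -/
def regularSubring (F : Type*) [Field F] : Subring (RatFunc F) :=
  (HahnSeries.ofPowerSeries ℤ F).range.comap (algebraMap (RatFunc F) F⸨X⸩)

lemma mem_regularSubring {F : Type*} [Field F] {r : RatFunc F} :
    r ∈ regularSubring F ↔ ∃ f, HasExpansion r f := by
  simp only [regularSubring, Subring.mem_comap, RingHom.mem_range, HasExpansion, eq_comm]

/-- The fraction `1 / (1 - t z^i)`. -/
def pole (i : ℕ) : RatTZ := (1 - tt * zz ^ i)⁻¹

lemma one_sub_ne_zero (i : ℕ) : (1 - tt * zz ^ i : RatTZ) ≠ 0 := by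
  have : (1 - tt * zz ^ i : RatTZ) =
      algebraMap (Polynomial (RatFunc ℂ)) RatTZ (1 - Polynomial.X * Polynomial.C (RatFunc.X ^ i)) := by
    simp [tt, zz]
  rw [this]
  refine RatFunc.algebraMap_ne_zero fun h => ?_
  simpa using congrArg (Polynomial.eval 0) h

lemma pole_hasExpansion (i : ℕ) :
    HasExpansion (pole i) (PowerSeries.mk fun n => ((RatFunc.X : RatFunc ℂ) ^ i) ^ n) := by
  refine HasExpansion.inv_of_mul_eq_one
    (f := 1 - PowerSeries.X * PowerSeries.C (RatFunc.X ^ i)) ?_ ?_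
  · have := (HasExpansion.one (F := RatFunc ℂ)).add
      (HasExpansion.X.mul (HasExpansion.C ((RatFunc.X : RatFunc ℂ) ^ i))).neg
    simpa [sub_eq_add_neg, tt, zz] using this
  · ext (_ | n)
    · simp
    · rw [sub_mul, one_mul, mul_assoc, map_sub, PowerSeries.coeff_succ_X_mul,
        PowerSeries.coeff_C_mul, PowerSeries.coeff_mk, PowerSeries.coeff_mk, pow_succ', sub_self,
        PowerSeries.coeff_one, if_neg (Nat.succ_ne_zero n)]

lemma one_sub_X_pow_ne_zero {e : ℕ} (he : e ≠ 0) : (1 - RatFunc.X ^ e : RatFunc ℂ) ≠ 0 := by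
  have : (1 - RatFunc.X ^ e : RatFunc ℂ) =
      algebraMap (Polynomial ℂ) (RatFunc ℂ) (1 - Polynomial.X ^ e) := by simp
  rw [this]
  refine RatFunc.algebraMap_ne_zero fun h => ?_
  simpa [he] using congrArg (Polynomial.eval 0) h

lemma inv_one_sub_X_pow_mem {e : ℕ} (he : e ≠ 0) :
    (1 - RatFunc.X ^ e : RatFunc ℂ)⁻¹ ∈ regularSubring ℂ := by
  refine mem_regularSubring.mpr ⟨_, HasExpansion.inv (f := 1 - PowerSeries.X ^ e) ?_ ?_⟩
  · simpa [sub_eq_add_neg] using (HasExpansion.one (F := ℂ)).add (HasExpansion.X.pow e).neg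
  · simp [he]

lemma X_mem_regularSubring : (RatFunc.X : RatFunc ℂ) ∈ regularSubring ℂ :=
  mem_regularSubring.mpr ⟨_, HasExpansion.X⟩

lemma pole_mul_pole_of_lt {i j : ℕ} (h : i < j) :
    pole i * pole j = RatFunc.C ((1 - RatFunc.X ^ (j - i) : RatFunc ℂ)⁻¹) * pole i -
      RatFunc.C (RatFunc.X ^ (j - i) * (1 - RatFunc.X ^ (j - i) : RatFunc ℂ)⁻¹) * pole j := by
  obtain ⟨e, rfl⟩ := Nat.exists_eq_add_of_lt h
  have h1 := one_sub_ne_zero i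
  have h2 := one_sub_ne_zero (i + e + 1)
  have h3 : (1 - zz ^ (e + 1) : RatTZ) ≠ 0 := by
    have : (RatFunc.C (1 - RatFunc.X ^ (e + 1) : RatFunc ℂ) : RatTZ) ≠ 0 :=
      (map_ne_zero _).mpr (one_sub_X_pow_ne_zero (Nat.succ_ne_zero e))
    simpa [zz] using this
  have h4 : i + e + 1 - i = e + 1 := by omega
  simp only [h4, map_mul, map_inv₀, map_sub, map_one, map_pow]
  change _ = (1 - zz ^ (e + 1))⁻¹ * pole i - zz ^ (e + 1) * (1 - zz ^ (e + 1))⁻¹ * _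
  unfold pole
  field_simp
  ring

/-- The product of two distinct poles, the coefficient of the second one being divisible by `z` if
it has the larger index. -/
lemma exists_pole_mul_pole_eq {i j : ℕ} (h : i ≠ j) :
    ∃ a b : RatFunc ℂ, a ∈ regularSubring ℂ ∧ b ∈ regularSubring ℂ ∧
      (i < j → b * RatFunc.X⁻¹ ∈ regularSubring ℂ) ∧
      pole i * pole j = RatFunc.C a * pole i + RatFunc.C b * pole j := by
  rcases lt_or_gt_of_ne h with h | h
  · have hreg := inv_one_sub_X_pow_mem (Nat.sub_ne_zero_of_lt h)
    refine ⟨_, -(RatFunc.X ^ (j - i) * (1 - RatFunc.X ^ (j - i))⁻¹), hreg, neg_mem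
      (mul_mem (pow_mem X_mem_regularSubring _) hreg), fun _ => ?_, ?_⟩
    · have : -(RatFunc.X ^ (j - i) * (1 - RatFunc.X ^ (j - i) : RatFunc ℂ)⁻¹) * RatFunc.X⁻¹ =
          -(RatFunc.X ^ (j - i - 1) * (1 - RatFunc.X ^ (j - i) : RatFunc ℂ)⁻¹) := by
        obtain ⟨e, he⟩ := Nat.exists_eq_succ_of_ne_zero (Nat.sub_ne_zero_of_lt h)
        rw [he, Nat.succ_sub_one, Nat.succ_eq_add_one, pow_succ (RatFunc.X : RatFunc ℂ) e]
        have := RatFunc.X_ne_zero (K := ℂ)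
        field_simp
      rw [this]
      exact neg_mem (mul_mem (pow_mem X_mem_regularSubring _) hreg)
    · rw [pole_mul_pole_of_lt h, map_neg]; ring
  · have hreg := inv_one_sub_X_pow_mem (Nat.sub_ne_zero_of_lt h)
    refine ⟨-(RatFunc.X ^ (i - j) * (1 - RatFunc.X ^ (i - j))⁻¹), _, neg_mem
      (mul_mem (pow_mem X_mem_regularSubring _) hreg), hreg, fun h' => absurd h' h.asymm, ?_⟩
    rw [mul_comm, pole_mul_pole_of_lt h, map_neg]; ring

/-- The factor that makes the coefficients at the poles of positive index vanish at `z = 0`. -/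
def poleCoeff (i : ℕ) : RatFunc ℂ := if i = 0 then 1 else RatFunc.X

/-- The sums of multiples of the `1 / (1 - t z^i)^k`, `1 ≤ k ≤ β i`, with coefficients that are
regular at `z = 0` and that vanish there if `i ≠ 0`. -/
def poleSpan (β : ℕ → ℕ) : AddSubmonoid RatTZ :=
  AddSubmonoid.closure {x | ∃ i k a, k < β i ∧ a ∈ regularSubring ℂ ∧
    x = RatFunc.C a * (RatFunc.C (poleCoeff i) * pole i ^ (k + 1))}

lemma C_mul_mem_poleSpan {β : ℕ → ℕ} {a : RatFunc ℂ} (ha : a ∈ regularSubring ℂ) {x : RatTZ}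
    (hx : x ∈ poleSpan β) : RatFunc.C a * x ∈ poleSpan β := by
  induction hx using AddSubmonoid.closure_induction with
  | mem x hx =>
    obtain ⟨i, k, b, hk, hb, rfl⟩ := hx
    rw [← mul_assoc, ← map_mul]
    exact AddSubmonoid.subset_closure ⟨i, k, _, hk, mul_mem ha hb, rfl⟩
  | zero => rw [mul_zero]; exact zero_mem _
  | add x y _ _ hx hy => rw [mul_add]; exact add_mem hx hy

lemma pole_mem_poleSpan {β : ℕ → ℕ} {i k : ℕ} (hk : k < β i) :
    RatFunc.C (poleCoeff i) * pole i ^ (k + 1) ∈ poleSpan β :=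
  AddSubmonoid.subset_closure ⟨i, k, 1, hk, one_mem _, by rw [map_one, one_mul]⟩

lemma pole_pow_mul_pole_mem {β : ℕ → ℕ} {i j k : ℕ} (hj : j ≠ 0) (hk : k < β i) :
    RatFunc.C (poleCoeff i) * pole i ^ (k + 1) * pole j ∈ poleSpan (β + Pi.single j 1) := by
  rcases eq_or_ne i j with rfl | hij
  · rw [mul_assoc, ← pow_succ]
    exact pole_mem_poleSpan (by simpa using hk)
  obtain ⟨a, b, ha, hb, hb', hab⟩ := exists_pole_mul_pole_eq hij
  have hβ : (β + Pi.single j 1 : ℕ → ℕ) i = β i := by simp [hij]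
  induction k with
  | zero =>
    have h1 : RatFunc.C (poleCoeff i) * pole i ^ (0 + 1) * pole j =
        RatFunc.C a * (RatFunc.C (poleCoeff i) * pole i ^ (0 + 1)) +
          RatFunc.C (poleCoeff i * b * (poleCoeff j)⁻¹) *
            (RatFunc.C (poleCoeff j) * pole j ^ (0 + 1)) := by
      have hX : (RatFunc.C RatFunc.X : RatTZ) ≠ 0 :=
        (map_ne_zero _).mpr RatFunc.X_ne_zero
      rw [zero_add, pow_one, pow_one, mul_assoc, hab, map_mul, map_mul, map_inv₀]
      simp only [poleCoeff, if_neg hj]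
      field_simp
    rw [h1]
    refine add_mem (C_mul_mem_poleSpan ha (pole_mem_poleSpan (hβ.symm ▸ hk)))
      (C_mul_mem_poleSpan ?_ (pole_mem_poleSpan (by simp)))
    rw [poleCoeff, poleCoeff, if_neg hj]
    -- If `i = 0` then `i < j` and `b` itself is divisible by `z`; otherwise the factor `z` attached
    -- to the pole `i` passes to the pole `j`.
    split_ifs with hi
    · rw [one_mul]; exact hb' (by omega)
    · have hX : (RatFunc.X : RatFunc ℂ) ≠ 0 := RatFunc.X_ne_zero
      rwa [mul_comm, inv_mul_cancel_left₀ hX]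
  | succ k ih =>
    have h1 : RatFunc.C (poleCoeff i) * pole i ^ (k + 1 + 1) * pole j =
        RatFunc.C a * (RatFunc.C (poleCoeff i) * pole i ^ (k + 1 + 1)) +
          RatFunc.C b * (RatFunc.C (poleCoeff i) * pole i ^ (k + 1) * pole j) := by
      rw [pow_succ _ (k + 1), mul_assoc, mul_assoc, hab]; ring
    rw [h1]
    exact add_mem (C_mul_mem_poleSpan ha (pole_mem_poleSpan (hβ.symm ▸ hk)))
      (C_mul_mem_poleSpan hb (ih (by omega)))

lemma mul_pole_mem {β : ℕ → ℕ} {j : ℕ} (hj : j ≠ 0) {x : RatTZ} (hx : x ∈ poleSpan β) :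
    x * pole j ∈ poleSpan (β + Pi.single j 1) := by
  induction hx using AddSubmonoid.closure_induction with
  | mem x hx =>
    obtain ⟨i, k, a, hk, ha, rfl⟩ := hx
    rw [mul_assoc]
    exact C_mul_mem_poleSpan ha (pole_pow_mul_pole_mem hj hk)
  | zero => rw [zero_mul]; exact zero_mem _
  | add x y _ _ hx hy => rw [add_mul]; exact add_mem hx hy

lemma prod_pole_mem_poleSpan {ι : Type*} [Fintype ι] (e : ι → ℕ) (h : ∃ p, e p = 0) :
    ∏ p, pole (e p) ∈ poleSpan fun i => (Finset.univ.filter fun p => e p = i).card := by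
  classical
  set Z := Finset.univ.filter fun p => e p = 0 with hZ
  have key : ∀ T : Finset ι, Disjoint Z T → ∏ p ∈ Z ∪ T, pole (e p) ∈
      poleSpan fun i => ((Z ∪ T).filter fun p => e p = i).card := by
    intro T
    induction T using Finset.induction_on with
    | empty =>
      intro _
      -- The start is a positive power of `1 / (1 - t)`. With no factor of index 0 the vanishing at
      -- `z = 0` would fail, as `1 / (1 - t z)` shows.
      obtain ⟨p, hp⟩ := h
      have hpos : 0 < Z.card := Finset.card_pos.mpr ⟨p, by simp [hZ, hp]⟩
      have h1 : ∏ p ∈ Z ∪ ∅, pole (e p) = RatFunc.C (poleCoeff 0) * pole 0 ^ (Z.card - 1 + 1) := by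
        rw [Finset.union_empty, Nat.sub_add_cancel hpos, poleCoeff, if_pos rfl, map_one, one_mul]
        exact Finset.prod_eq_pow_card fun p hp => by rw [(Finset.mem_filter.mp hp).2]
      rw [h1]
      refine pole_mem_poleSpan ?_
      rw [Finset.union_empty, Finset.filter_true_of_mem fun p hp => (Finset.mem_filter.mp hp).2]
      exact Nat.sub_lt hpos one_pos
    | insert p T hp ih =>
      intro hdis
      rw [Finset.disjoint_insert_right] at hdis
      have hpe : e p ≠ 0 := fun h0 => hdis.1 (by simp [hZ, h0])
      have hpn : p ∉ Z ∪ T := by simp [hdis.1, hp]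
      have := mul_pole_mem hpe (ih hdis.2)
      rw [Finset.union_insert, Finset.prod_insert hpn, mul_comm]
      convert this using 2
      funext i
      rw [Finset.filter_insert, Pi.add_apply]
      split_ifs with hi
      · rw [Finset.card_insert_of_notMem (by simp [hpn]), hi, Pi.single_eq_same]
      · rw [Pi.single_eq_of_ne (Ne.symm hi), add_zero]
  have := key Zᶜ disjoint_compl_right
  rwa [Finset.union_compl] at this

end

/-! ### Existence and uniqueness of the partial fractions -/

section

open scoped LaurentSeries RatFunc

/-- An element of `poleSpan β` is a sum of partial fractions whose coefficients are power series,
without constant term at the poles of positive index. -/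
lemma exists_eq_sum_of_mem_poleSpan {β : ℕ → ℕ} {n : ℕ} (hβ : ∀ i, n ≤ i → β i = 0) {x : RatTZ}
    (hx : x ∈ poleSpan β) :
    ∃ (A : ℕ → ℕ → RatFunc ℂ) (f : ℕ → ℕ → PowerSeries ℂ),
      (∀ i k, HasExpansion (A i k) (f i k)) ∧
      (∀ i k, i ≠ 0 → PowerSeries.constantCoeff (f i k) = 0) ∧
      x = ∑ i ∈ Finset.range n, ∑ k ∈ Finset.Icc 1 (β i), RatFunc.C (A i k) * pole i ^ k := by
  induction hx using AddSubmonoid.closure_induction with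
  | mem x hx =>
    obtain ⟨i, k, a, hk, ha, rfl⟩ := hx
    obtain ⟨u, hu⟩ := mem_regularSubring.mp ha
    refine ⟨Pi.single i (Pi.single (k + 1) (a * poleCoeff i)),
      Pi.single i (Pi.single (k + 1) (u * if i = 0 then 1 else PowerSeries.X)),
      fun i' k' => ?_, fun i' k' hi' => ?_, ?_⟩
    · by_cases h : i' = i
      · subst h
        rw [Pi.single_eq_same, Pi.single_eq_same]
        by_cases h : k' = k + 1
        · subst h
          rw [Pi.single_eq_same, Pi.single_eq_same, poleCoeff]
          split_ifs
          exacts [hu.mul HasExpansion.one, hu.mul HasExpansion.X]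
        · rw [Pi.single_eq_of_ne h, Pi.single_eq_of_ne h]
          exact HasExpansion.zero
      · rw [Pi.single_eq_of_ne h, Pi.single_eq_of_ne h]
        exact HasExpansion.zero
    · by_cases h : i' = i
      · subst h
        rw [Pi.single_eq_same, if_neg hi']
        by_cases h : k' = k + 1
        · subst h
          rw [Pi.single_eq_same, map_mul, PowerSeries.constantCoeff_X, mul_zero]
        · rw [Pi.single_eq_of_ne h, map_zero]
      · rw [Pi.single_eq_of_ne h, Pi.zero_apply, map_zero]
    · have hi : i < n := by
        by_contra! h
        rw [hβ i h] at hk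
        exact absurd hk (Nat.not_lt_zero _)
      rw [Finset.sum_eq_single_of_mem i (Finset.mem_range.mpr hi),
        Finset.sum_eq_single_of_mem (k + 1) (Finset.mem_Icc.mpr ⟨by omega, hk⟩)]
      · rw [Pi.single_eq_same, Pi.single_eq_same, map_mul, mul_assoc]
      · intro k' _ hk'
        rw [Pi.single_eq_same, Pi.single_eq_of_ne hk', map_zero, zero_mul]
      · intro i' _ hi'
        refine Finset.sum_eq_zero fun k' _ => ?_
        rw [Pi.single_eq_of_ne hi', Pi.zero_apply, map_zero, zero_mul]
  | zero =>
    refine ⟨0, 0, fun _ _ => HasExpansion.zero, fun _ _ _ => map_zero _, ?_⟩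
    refine (Finset.sum_eq_zero fun i _ => Finset.sum_eq_zero fun k _ => ?_).symm
    rw [Pi.zero_apply, Pi.zero_apply, map_zero, zero_mul]
  | add x y _ _ hx hy =>
    obtain ⟨A, f, h1, h2, h3⟩ := hx
    obtain ⟨B, g, h1', h2', h3'⟩ := hy
    refine ⟨A + B, f + g, fun i k => (h1 i k).add (h1' i k), fun i k hi => ?_, ?_⟩
    · rw [Pi.add_apply, Pi.add_apply, map_add, h2 i k hi, h2' i k hi, add_zero]
    · rw [h3, h3']
      simp only [Pi.add_apply, map_add, add_mul, Finset.sum_add_distrib]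

lemma neg_mul_inv_mul_sub_inv {L : Type*} [Field L] {t w : L} (h : 1 - t * w ≠ 0) (hw : w ≠ 0) :
    -w * (1 - t * w)⁻¹ * (t - w⁻¹) = 1 := by
  have h1 : t - w⁻¹ = -w⁻¹ * (1 - t * w) := by field_simp; ring
  rw [h1, mul_assoc, mul_left_comm _ (-w⁻¹), inv_mul_cancel₀ h, mul_one, neg_mul_neg,
    mul_inv_cancel₀ hw]

lemma zz_ne_zero : zz ≠ 0 :=
  (map_ne_zero (RatFunc.C : RatFunc ℂ →+* RatTZ)).mpr RatFunc.X_ne_zero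

lemma zz_pow_ne_zero (i : ℕ) : zz ^ i ≠ 0 := by
  have h := (map_ne_zero (RatFunc.C : RatFunc ℂ →+* RatTZ)).mpr
    (pow_ne_zero i (RatFunc.X_ne_zero (K := ℂ)))
  rwa [map_pow] at h

/-- Rewriting `1 - t z^i = -z^i (t - z^{-i})` gives monic linear denominators in `t` with distinct
roots, hence pairwise coprime, and constant numerators. -/
lemma poles_unique {n : ℕ} {β : ℕ → ℕ} {A B : ℕ → ℕ → RatFunc ℂ}
    (h : ∑ i ∈ Finset.range n, ∑ k ∈ Finset.Icc 1 (β i), RatFunc.C (A i k) * pole i ^ k =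
      ∑ i ∈ Finset.range n, ∑ k ∈ Finset.Icc 1 (β i), RatFunc.C (B i k) * pole i ^ k)
    {i k : ℕ} (hi : i < n) (hk : k ∈ Finset.Icc 1 (β i)) : A i k = B i k := by
  let a : ℕ → RatFunc ℂ := fun i => (RatFunc.X ^ i)⁻¹
  have hX : ∀ i, (RatFunc.X : RatFunc ℂ) ^ i ≠ 0 := fun i => pow_ne_zero i RatFunc.X_ne_zero
  let g : ℕ → Polynomial (RatFunc ℂ) := fun i => Polynomial.X - Polynomial.C (a i)
  let gi : ℕ → RatTZ := fun i => -zz ^ i * pole i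
  have hCa : ∀ i, RatFunc.C (a i) = (zz ^ i)⁻¹ := fun i => by
    simp only [a, map_inv₀, map_pow]; rfl
  have hpole : ∀ i, pole i = RatFunc.C (-a i) * gi i := fun i => by
    have h2 : (zz ^ i)⁻¹ * zz ^ i = (1 : RatTZ) :=
      inv_mul_cancel₀ (G₀ := RatTZ) (zz_pow_ne_zero i)
    simp only [gi, map_neg, hCa]
    rw [← mul_assoc, neg_mul_neg, h2, one_mul]
  have hgg : ∀ i, gi i * algebraMap (Polynomial (RatFunc ℂ)) RatTZ (g i) = 1 := fun i => by
    simp only [gi, g, pole, map_sub, RatFunc.algebraMap_X, RatFunc.algebraMap_C, hCa]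
    exact neg_mul_inv_mul_sub_inv (L := RatTZ) (one_sub_ne_zero i) (zz_pow_ne_zero i)
  have hinj : Function.Injective a := fun i j hij => by
    have : (RatFunc.X : RatFunc ℂ) ^ i = RatFunc.X ^ j := inv_injective hij
    rw [← RatFunc.algebraMap_X, ← map_pow, ← map_pow] at this
    simpa using congrArg Polynomial.natDegree (RatFunc.algebraMap_injective ℂ this)
  have hsum : ∀ A : ℕ → ℕ → RatFunc ℂ,
      ∑ i ∈ Finset.range n, ∑ k ∈ Finset.Icc 1 (β i), RatFunc.C (A i k) * pole i ^ k =
      algebraMap (Polynomial (RatFunc ℂ)) RatTZ 0 + ∑ i ∈ Finset.range n, ∑ k : Fin (β i),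
        algebraMap (Polynomial (RatFunc ℂ)) RatTZ
          (Polynomial.C (A i (k.1 + 1) * (-a i) ^ (k.1 + 1))) * gi i ^ (k.1 + 1) := fun A => by
    rw [map_zero, zero_add]
    refine Finset.sum_congr rfl fun i _ => ?_
    rw [Fin.sum_univ_eq_sum_range (fun k => algebraMap (Polynomial (RatFunc ℂ)) RatTZ
      (Polynomial.C (A i (k + 1) * (-a i) ^ (k + 1))) * gi i ^ (k + 1)),
      Finset.range_eq_Ico, Finset.sum_Ico_add' (fun k => algebraMap (Polynomial (RatFunc ℂ)) RatTZ
      (Polynomial.C (A i k * (-a i) ^ k)) * gi i ^ k) 0 (β i) 1]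
    refine Finset.sum_congr rfl fun k _ => ?_
    rw [RatFunc.algebraMap_C, map_mul, map_pow, mul_assoc, ← mul_pow, ← hpole]
  rw [hsum, hsum] at h
  have hdeg : ∀ (i : ℕ) (c : RatFunc ℂ), (Polynomial.C c).degree < (g i).degree := fun i c => by
    simp only [g, Polynomial.degree_X_sub_C]
    exact Polynomial.degree_C_lt
  have key := (Polynomial.quo_add_sum_rem_mul_pow_inverse_unique
    (fun i _ => Polynomial.monic_X_sub_C (a i))
    (fun i _ j _ hij => Polynomial.isCoprime_X_sub_C_of_isUnit_sub
      (sub_ne_zero.mpr (hinj.ne hij)).isUnit) (fun i _ => hgg i)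
    (fun i _ j => hdeg i _) (fun i _ j => hdeg i _) h).2 i (Finset.mem_range.mpr hi)
  obtain ⟨hk1, hk2⟩ := Finset.mem_Icc.mp hk
  have := Polynomial.C_injective (congrFun key ⟨k - 1, by omega⟩)
  simp only [Nat.sub_add_cancel hk1] at this
  exact mul_right_cancel₀ (pow_ne_zero k (neg_ne_zero.mpr (inv_ne_zero (hX i)))) this

end

/-! ### Extraction of the diagonal coefficients -/

section

open scoped LaurentSeries RatFunc

lemma coeff_geometric_pow {R : Type*} [CommRing R] (a : R) {k : ℕ} (hk : 1 ≤ k) (m : ℕ) :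
    PowerSeries.coeff m ((PowerSeries.mk fun n => a ^ n) ^ k) =
      a ^ m * ((k - 1 + m).choose (k - 1) : ℕ) := by
  obtain ⟨k, rfl⟩ := Nat.exists_eq_add_of_le' hk
  have : (PowerSeries.mk fun n => a ^ n) = PowerSeries.rescale a (PowerSeries.mk 1) := by
    ext n; simp [PowerSeries.coeff_rescale]
  rw [this, ← map_pow, PowerSeries.coeff_rescale, PowerSeries.mk_one_pow_eq_mk_choose_add,
    PowerSeries.coeff_mk, Nat.add_sub_cancel]

lemma coeff_prod_geometric {R ι : Type*} [CommRing R] [Fintype ι] [DecidableEq ι] (x : R)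
    (e : ι → ℕ) (m : ℕ) :
    PowerSeries.coeff m (∏ p, PowerSeries.mk fun n => (x ^ e p) ^ n) =
      ∑ t ∈ Finset.finsuppAntidiag Finset.univ m, x ^ ∑ p, e p * t p := by
  rw [PowerSeries.coeff_prod]
  refine Finset.sum_congr rfl fun t _ => ?_
  simp only [PowerSeries.coeff_mk, ← pow_mul, Finset.prod_pow_eq_pow_sum]

lemma coeff_springerOp {k : ℕ} (hk : 1 ≤ k) (a : PowerSeries ℂ) (m : ℕ) :
    PowerSeries.coeff m (springerOp k a) =
      ((k - 1 + m).choose (k - 1) : ℕ) * PowerSeries.coeff m a := by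
  obtain ⟨k, rfl⟩ := Nat.exists_eq_add_of_le' hk
  rw [springerOp, Nat.add_sub_cancel, map_smul, PowerSeries.coeff_iterate_derivative,
    PowerSeries.coeff_X_pow_mul, smul_eq_mul, ← mul_assoc]
  congr 1
  rw [inv_mul_eq_iff_eq_mul₀ (by exact_mod_cast k.factorial_ne_zero), add_comm k m]
  have h1 := Nat.ascFactorial_eq_factorial_mul_choose m k
  rw [add_comm m k, Nat.add_comm k m] at h1
  exact_mod_cast h1

variable {s : ℕ} (d : Fin s → ℕ)

/-- The exponent `d^* + d_j - 2 l` of `z` in the factor of `f_d(t z^{d^*}, z)` at `(j, l)`. -/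
def shiftedWeight (p : Var d) : ℕ := dmax d + d p.1 - 2 * p.2.val

lemma coe_shiftedWeight (p : Var d) : (shiftedWeight d p : ℤ) = dmax d + varWeight d p := by
  have h : d p.1 ≤ dmax d := Finset.le_sup (f := d) (Finset.mem_univ p.1)
  have := p.2.isLt
  unfold shiftedWeight varWeight
  omega

lemma beta_eq (i : ℕ) :
    beta d i = (Finset.univ.filter fun p => shiftedWeight d p = i).card := by
  unfold beta
  congr 1
  refine Finset.filter_congr fun p _ => ?_
  rw [← Int.natCast_inj, coe_shiftedWeight, varWeight, add_sub_assoc]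

lemma beta_eq_zero {i : ℕ} (hi : 2 * dmax d + 1 ≤ i) : beta d i = 0 := by
  rw [beta_eq, Finset.card_eq_zero, Finset.filter_eq_empty_iff]
  intro p _
  have h : d p.1 ≤ dmax d := Finset.le_sup (f := d) (Finset.mem_univ p.1)
  unfold shiftedWeight
  omega

/-- The last variable of a form of maximal degree has weight `-d*`. -/
lemma exists_shiftedWeight_eq_zero (hs : 0 < s) : ∃ p, shiftedWeight d p = 0 := by
  obtain ⟨j, -, hj⟩ := Finset.exists_mem_eq_sup Finset.univ ⟨⟨0, hs⟩, Finset.mem_univ _⟩ d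
  refine ⟨⟨j, Fin.last _⟩, ?_⟩
  have : dmax d = d j := hj
  simp only [shiftedWeight, Fin.val_last]
  omega

lemma fd_eq : fd d (tt * zz ^ dmax d) zz = ∏ p, pole (shiftedWeight d p) := by
  rw [fd, Fintype.prod_sigma]
  refine Finset.prod_congr rfl fun j _ => ?_
  rw [Finset.prod_range]
  refine Finset.prod_congr rfl fun l _ => ?_
  rw [pole, mul_assoc, ← zpow_natCast zz (dmax d), ← zpow_add₀ (G₀ := RatTZ) zz_ne_zero,
    ← zpow_natCast zz (shiftedWeight d ⟨j, l⟩), coe_shiftedWeight]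
  rfl

lemma div_pow_eq_mul_inv_pow {L : Type*} [Field L] (a b : L) (k : ℕ) :
    a / b ^ k = a * b⁻¹ ^ k := by
  rw [div_eq_mul_inv, inv_pow]

/-- The partial fraction decomposition of `f_d`, written as a sum of powers of `pole i`. -/
lemma isPartialFractionDecomposition_iff (A : ℕ → ℕ → RatFunc ℂ) :
    IsPartialFractionDecomposition d A ↔ ∏ p, pole (shiftedWeight d p) =
      ∑ i ∈ Finset.range (2 * dmax d + 1), ∑ k ∈ Finset.Icc 1 (beta d i),
        RatFunc.C (A i k) * pole i ^ k := by
  rw [IsPartialFractionDecomposition, fd_eq]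
  refine Eq.congr_right (Finset.sum_congr rfl fun i _ => Finset.sum_congr rfl fun k _ => ?_)
  exact div_pow_eq_mul_inv_pow (L := RatTZ) _ _ k

/-- The partial fraction decomposition of `f_d`, with the expansions at `z = 0` of its
coefficients. -/
lemma exists_isPartialFractionDecomposition (hs : 0 < s) :
    ∃ (A : ℕ → ℕ → RatFunc ℂ) (f : ℕ → ℕ → PowerSeries ℂ),
      IsPartialFractionDecomposition d A ∧ (∀ i k, HasExpansion (A i k) (f i k)) ∧
      ∀ i k, i ≠ 0 → PowerSeries.constantCoeff (f i k) = 0 := by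
  have h := prod_pole_mem_poleSpan (shiftedWeight d) (exists_shiftedWeight_eq_zero d hs)
  simp only [← beta_eq] at h
  obtain ⟨A, f, h1, h2, h3⟩ := exists_eq_sum_of_mem_poleSpan
    (n := 2 * dmax d + 1) (fun i hi => beta_eq_zero d hi) h
  exact ⟨A, f, (isPartialFractionDecomposition_iff d A).mpr h3, h1, h2⟩

/-- The coefficients of `t^m` in a partial fraction decomposition. -/
lemma sum_X_pow_eq_of_hasExpansion {F ι : Type*} [Field F] [Fintype ι] [DecidableEq ι]
    {g : ℕ → RatFunc (RatFunc F)}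
    (hg : ∀ i, HasExpansion (g i) (PowerSeries.mk fun n => ((RatFunc.X : RatFunc F) ^ i) ^ n))
    {e : ι → ℕ} {n : ℕ} {β : ℕ → ℕ} {A : ℕ → ℕ → RatFunc F} {f : ℕ → ℕ → PowerSeries F}
    (hA : ∏ p, g (e p) = ∑ i ∈ Finset.range n, ∑ k ∈ Finset.Icc 1 (β i),
      RatFunc.C (A i k) * g i ^ k)
    (hf : ∀ i k, HasExpansion (A i k) (f i k)) (m : ℕ) :
    ∑ t ∈ Finset.finsuppAntidiag Finset.univ m,
        (PowerSeries.X : PowerSeries F) ^ ∑ p, e p * t p =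
      ∑ i ∈ Finset.range n, ∑ k ∈ Finset.Icc 1 (β i),
        f i k * ((PowerSeries.X ^ i) ^ m *
          (((k - 1 + m).choose (k - 1) : ℕ) : PowerSeries F)) := by
  have h1 : HasExpansion (∏ p, g (e p)) _ := HasExpansion.prod fun p _ => hg (e p)
  have h2 : HasExpansion (∏ p, g (e p)) _ := hA ▸ HasExpansion.sum fun i _ =>
    HasExpansion.sum fun k _ => (HasExpansion.C (A i k)).mul ((hg i).pow k)
  have h3 := congrArg (PowerSeries.coeff m) (h1.unique h2)
  rw [coeff_prod_geometric, map_sum] at h3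
  -- The coefficients of `t^m` agree in the field of rational functions in `z`; uniqueness of
  -- expansions, now in `z`, gives the power series identity.
  refine HasExpansion.unique (HasExpansion.sum fun t _ => HasExpansion.X.pow _) ?_
  rw [h3]
  refine HasExpansion.sum fun i _ => ?_
  rw [map_sum]
  refine HasExpansion.sum fun k hk => ?_
  rw [PowerSeries.coeff_C_mul, coeff_geometric_pow _ (Finset.mem_Icc.mp hk).1]
  exact (hf i k).mul (((HasExpansion.X.pow i).pow m).mul (HasExpansion.natCast _))

lemma coeff_sum_X_pow (m j : ℕ) :
    PowerSeries.coeff (m * dmax d) ((PowerSeries.X : PowerSeries ℂ) ^ j *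
      ∑ t ∈ Finset.finsuppAntidiag Finset.univ m,
        (PowerSeries.X : PowerSeries ℂ) ^ ∑ p, shiftedWeight d p * t p) =
      monomialCount d m j := by
  simp only [Finset.mul_sum, ← pow_add, map_sum, PowerSeries.coeff_X_pow, Finset.sum_boole]
  congr 1
  -- The exponent condition `m d* = j + (m d* + weight)` selects weight `-j`.
  rw [← monomialCount_neg, monomialCount, ← Set.ncard_coe_finset]
  congr 1
  ext t
  simp only [Finset.coe_filter, Finset.mem_finsuppAntidiag, Finset.subset_univ, and_true,
    exponents, Set.mem_ofPred_eq, Set.mem_singleton_iff, Finsupp.degree_eq_sum]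
  refine and_congr_right fun ht => ?_
  rw [Finsupp.weight_apply, Finsupp.sum_fintype _ _ (by simp), ← Int.natCast_inj]
  push_cast
  simp only [coe_shiftedWeight, add_mul, Finset.sum_add_distrib, ← Finset.mul_sum]
  rw [← Nat.cast_sum, ht, mul_comm (dmax d : ℤ)]
  simp only [nsmul_eq_mul, mul_comm]
  omega

/-- The coefficients of `u · f_d(t z^{d^*}, z)` on the diagonal `t^m z^{m d^*}`. -/
lemma coeff_mul_sum_X_pow {A : ℕ → ℕ → RatFunc ℂ} {f : ℕ → ℕ → PowerSeries ℂ}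
    (hA : IsPartialFractionDecomposition d A) (hf : ∀ i k, HasExpansion (A i k) (f i k))
    (hf0 : ∀ i k, i ≠ 0 → PowerSeries.constantCoeff (f i k) = 0) (u : PowerSeries ℂ) (m : ℕ) :
    PowerSeries.coeff (m * dmax d) (u *
      ∑ t ∈ Finset.finsuppAntidiag Finset.univ m,
        (PowerSeries.X : PowerSeries ℂ) ^ ∑ p, shiftedWeight d p * t p) =
      ∑ i ∈ Finset.range (dmax d + 1), ∑ k ∈ Finset.Icc 1 (beta d i),
        PowerSeries.coeff m (springerOp k (phi (dmax d - i) (u * f i k))) := by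
  rw [sum_X_pow_eq_of_hasExpansion (F := ℂ) pole_hasExpansion
    ((isPartialFractionDecomposition_iff d A).mp hA) hf, Finset.mul_sum, map_sum]
  have hterm : ∀ i k, PowerSeries.coeff (m * dmax d)
      (u * (f i k * ((PowerSeries.X ^ i) ^ m *
        (((k - 1 + m).choose (k - 1) : ℕ) : PowerSeries ℂ)))) =
      ((k - 1 + m).choose (k - 1) : ℕ) * if i * m ≤ m * dmax d then
        PowerSeries.coeff (m * dmax d - i * m) (u * f i k) else 0 := fun i k => by
    have : u * (f i k * ((PowerSeries.X ^ i) ^ m *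
        (((k - 1 + m).choose (k - 1) : ℕ) : PowerSeries ℂ))) =
        PowerSeries.C (((k - 1 + m).choose (k - 1) : ℕ) : ℂ) *
          (PowerSeries.X ^ (i * m) * (u * f i k)) := by
      rw [map_natCast, pow_mul]; ring
    rw [this, PowerSeries.coeff_C_mul, PowerSeries.coeff_X_pow_mul']
  have hsub : Finset.range (dmax d + 1) ⊆ Finset.range (2 * dmax d + 1) :=
    Finset.range_subset_range.mpr (by omega)
  rw [← Finset.sum_subset hsub]
  · refine Finset.sum_congr rfl fun i hi => ?_
    have hi : i ≤ dmax d := Finset.mem_range_succ_iff.mp hi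
    rw [Finset.mul_sum, map_sum]
    refine Finset.sum_congr rfl fun k hk => ?_
    rw [hterm, coeff_springerOp (Finset.mem_Icc.mp hk).1, phi, PowerSeries.coeff_mk,
      if_pos (by rw [mul_comm i]; exact Nat.mul_le_mul_left m hi), mul_comm i, ← Nat.mul_sub]
  · intro i _ hi
    have hi : dmax d < i := by simpa [Nat.lt_succ_iff] using hi
    rw [Finset.mul_sum, map_sum]
    refine Finset.sum_eq_zero fun k _ => ?_
    rw [hterm]
    -- For `m = 0` the term is a multiple of the constant coefficient of `f i k`, which is zero; for
    -- `m > 0` the power `z^{i m}` exceeds `z^{m d*}`.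
    rcases Nat.eq_zero_or_pos m with rfl | hm
    · simp [hf0 i k (by omega)]
    · rw [if_neg (by rw [not_le, mul_comm i]; exact Nat.mul_lt_mul_of_pos_left hi hm), mul_zero]

end

end Weitzenbock

end

theorem theorem3p1 {K : Type*} [Field K] [CharZero K] (s : ℕ) (hs : 0 < s) (d : Fin s → ℕ) :
    (∃ A : ℕ → ℕ → RatFunc ℂ, Weitzenbock.IsPartialFractionDecomposition d A) ∧
    ∀ A : ℕ → ℕ → RatFunc ℂ, Weitzenbock.IsPartialFractionDecomposition d A →
      (∀ i ≤ 2 * Weitzenbock.dmax d, ∀ k ∈ Finset.Icc 1 (Weitzenbock.beta d i),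
        Weitzenbock.RegularAtZero (A i k)) ∧
      PowerSeries.map (Int.castRingHom ℂ) (Weitzenbock.PI K d) =
        ∑ i ∈ Finset.range (Weitzenbock.dmax d + 1),
          ∑ k ∈ Finset.Icc 1 (Weitzenbock.beta d i),
            Weitzenbock.springerOp k (Weitzenbock.phi (Weitzenbock.dmax d - i)
              ((1 - (PowerSeries.X : PowerSeries ℂ) ^ 2) * Weitzenbock.expansion (A i k))) ∧
      PowerSeries.map (Int.castRingHom ℂ) (Weitzenbock.PS K d) =
        ∑ i ∈ Finset.range (Weitzenbock.dmax d + 1),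
          ∑ k ∈ Finset.Icc 1 (Weitzenbock.beta d i),
            Weitzenbock.springerOp k (Weitzenbock.phi (Weitzenbock.dmax d - i)
              ((1 + (PowerSeries.X : PowerSeries ℂ)) * Weitzenbock.expansion (A i k))) := by
  obtain ⟨B, f, hB, hf, hf0⟩ := Weitzenbock.exists_isPartialFractionDecomposition d hs
  refine ⟨⟨B, hB⟩, fun A hA => ?_⟩
  -- Only the coefficients occurring in the decomposition are determined; elsewhere `A` is
  -- arbitrary.
  have hAB : ∀ i ≤ 2 * Weitzenbock.dmax d, ∀ k ∈ Finset.Icc 1 (Weitzenbock.beta d i),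
      Weitzenbock.HasExpansion (A i k) (f i k) := fun i hi k hk => by
    rw [Weitzenbock.poles_unique
      (((Weitzenbock.isPartialFractionDecomposition_iff d A).mp hA).symm.trans
        ((Weitzenbock.isPartialFractionDecomposition_iff d B).mp hB)) (Nat.lt_succ_of_le hi) hk]
    exact hf i k
  have hsum : ∀ (u : PowerSeries ℂ) (m : ℕ), PowerSeries.coeff m
      (∑ i ∈ Finset.range (Weitzenbock.dmax d + 1), ∑ k ∈ Finset.Icc 1 (Weitzenbock.beta d i),
        Weitzenbock.springerOp k (Weitzenbock.phi (Weitzenbock.dmax d - i)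
          (u * Weitzenbock.expansion (A i k)))) = PowerSeries.coeff (m * Weitzenbock.dmax d) (u *
        ∑ t ∈ Finset.finsuppAntidiag Finset.univ m,
          PowerSeries.X ^ ∑ p, Weitzenbock.shiftedWeight d p * t p) := fun u m => by
    rw [Weitzenbock.coeff_mul_sum_X_pow d hB hf hf0 u m, map_sum]
    refine Finset.sum_congr rfl fun i hi => ?_
    rw [map_sum]
    refine Finset.sum_congr rfl fun k hk => ?_
    have hi : i ≤ Weitzenbock.dmax d := Finset.mem_range_succ_iff.mp hi
    rw [Weitzenbock.expansion, (hAB i (by omega) k hk).num_mul_inv_denom]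
  have hcount := Weitzenbock.coeff_sum_X_pow d
  refine ⟨fun i hi k hk => (hAB i hi k hk).denom_eval_zero_ne_zero, ?_, ?_⟩
  · ext m
    have h0 := hcount m 0
    have h2 := hcount m 2
    rw [pow_zero, one_mul] at h0
    rw [hsum, sub_mul, one_mul, map_sub, h0, h2, PowerSeries.coeff_map, Weitzenbock.coeff_PI]
    simp
  · ext m
    have h0 := hcount m 0
    have h1 := hcount m 1
    rw [pow_zero, one_mul] at h0
    rw [pow_one] at h1
    rw [hsum, add_mul, one_mul, map_add, h0, h1, PowerSeries.coeff_map, Weitzenbock.coeff_PS]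
    simp
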